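/- Let $H$ be a complex Hilbert space and let $T=(T_1,T_2)$ be a pair of commuting bounded operators on $H$. Its Koszul complex $K(T_1,T_2;H)$ is $$0\to H\xrightarrow{\,x\mapsto(-T_2x,\;T_1x)\,}H\oplus H\xrightarrow{\,(x,y)\mapsto T_1x+T_2y\,}H\to 0,$$ with homology spaces $H_iK(T_1,T_2;H)$, $i=2,1,0$. The pair is called Fredholm if all three homology spaces are finite dimensional, and then $\operatorname{index}(T_1,T_2)=\sum_{i=0}^{2}(-1)^{i}\dim H_iK(T_1,T_2;H)$. Put $h_i(k)=\dim H_iK(T_1^k,T_2^k;H)$ for $k\in\mathbb N$ and $i=0,1,2$. Theorem 3. Assume that $(T_1,T_2)$ is Fredholm. Then every pair $(T_1^t,T_2^s)$ with integers $t,s\ge 0$ is Fredholm, and the following hold. (i) For each $i=0,1,2$ the limit $e_i=e_i(T_1,T_2)=\lim_{k\to\infty}h_i(k)/k^2$ exists and is an integer. (ii) $\operatorname{index}(T_1,T_2)=e_2-e_1+e_0$. (iii) For all integers $t,s\ge 0$ and $i=0,1,2$, the limit $e_i(T_1^t,T_2^s)$ exists and $e_i(T_1^t,T_2^s)=t\,s\,e_i(T_1,T_2)$.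 Moreover, for each $i=0,1,2$ there is a Fredholm pair of commuting bounded operators on some complex Hilbert space for which $h_i$ does not coincide with any polynomial for all sufficiently large $k$, and for each $i=0,1,2$ there is such a pair with $e_i>0$. -/

import Mathlib

open Filter Topology

universe u

namespace KoszulPair

variable {H : Type u} [NormedAddCommGroup H] [InnerProductSpace ℂ H]

/-- The differential `K₂ = H → K₁ = H × H` of the Koszul complex `K(T₁, T₂; H)`, which is the total
complex of `H ⊗ K(z₁) ⊗ K(z₂)`, written out: `x ↦ (-T₂ x, T₁ x)`. -/
def d₂ (T₁ T₂ : H →L[ℂ] H) : H →ₗ[ℂ] H × H :=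
  LinearMap.prod (-(T₂ : H →ₗ[ℂ] H)) (T₁ : H →ₗ[ℂ] H)

/-- The differential `K₁ = H × H → K₀ = H` of the Koszul complex `K(T₁, T₂; H)`:
`(x, y) ↦ T₁ x + T₂ y`. -/
def d₁ (T₁ T₂ : H →L[ℂ] H) : H × H →ₗ[ℂ] H :=
  LinearMap.coprod (T₁ : H →ₗ[ℂ] H) (T₂ : H →ₗ[ℂ] H)

theorem d₂_apply (T₁ T₂ : H →L[ℂ] H) (x : H) : d₂ T₁ T₂ x = (-T₂ x, T₁ x) := rfl

theorem d₁_apply (T₁ T₂ : H →L[ℂ] H) (x : H × H) : d₁ T₁ T₂ x = T₁ x.1 + T₂ x.2 := rfl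

/-- For a commuting pair, `0 → H → H × H → H → 0` is a complex. -/
theorem d₁_comp_d₂ {T₁ T₂ : H →L[ℂ] H} (hT : Commute T₁ T₂) : d₁ T₁ T₂ ∘ₗ d₂ T₁ T₂ = 0 := by
  ext x
  have h : T₁ (T₂ x) = T₂ (T₁ x) := congrArg (fun S : H →L[ℂ] H => S x) hT.eq
  simp [d₁_apply, d₂_apply, h]

/-- `H₀ K(T₁, T₂; H) = K₀ / im d₁`. -/
abbrev H₀ (T₁ T₂ : H →L[ℂ] H) : Type u :=
  H ⧸ LinearMap.range (d₁ T₁ T₂)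

/-- `H₁ K(T₁, T₂; H) = ker d₁ / im d₂`, the image being taken inside `ker d₁`. -/
abbrev H₁ (T₁ T₂ : H →L[ℂ] H) : Type u :=
  LinearMap.ker (d₁ T₁ T₂) ⧸
    (LinearMap.range (d₂ T₁ T₂)).comap (LinearMap.ker (d₁ T₁ T₂)).subtype

/-- `H₂ K(T₁, T₂; H) = ker d₂`. -/
abbrev H₂ (T₁ T₂ : H →L[ℂ] H) : Type u :=
  LinearMap.ker (d₂ T₁ T₂)

/-- The pair is Fredholm: every homology space of its Koszul complex is finite dimensional. -/
structure IsFredholm (T₁ T₂ : H →L[ℂ] H) : Prop where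
  finite_H₀ : FiniteDimensional ℂ (H₀ T₁ T₂)
  finite_H₁ : FiniteDimensional ℂ (H₁ T₁ T₂)
  finite_H₂ : FiniteDimensional ℂ (H₂ T₁ T₂)

/-- `dim H_i K(T₁, T₂; H)` for `i = 0, 1, 2`. -/
noncomputable def dimH (T₁ T₂ : H →L[ℂ] H) : Fin 3 → ℕ :=
  ![Module.finrank ℂ (H₀ T₁ T₂), Module.finrank ℂ (H₁ T₁ T₂), Module.finrank ℂ (H₂ T₁ T₂)]

/-- The Fredholm index `∑ i, (-1) ^ (2 - i) * dim H_i K(T₁, T₂; H)` of a pair. -/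
noncomputable def index (T₁ T₂ : H →L[ℂ] H) : ℤ :=
  (dimH T₁ T₂ 2 : ℤ) - (dimH T₁ T₂ 1 : ℤ) + (dimH T₁ T₂ 0 : ℤ)

/-- The homological Hilbert function `h_i(k) = dim H_i K(T₁ ^ k, T₂ ^ k; H)`. -/
noncomputable def hilbertFn (T₁ T₂ : H →L[ℂ] H) (i : Fin 3) (k : ℕ) : ℕ :=
  dimH (T₁ ^ k) (T₂ ^ k) i

/-- `e = lim h_i(k) / k ^ 2` as `k → ∞`. -/
def HasMultiplicity (T₁ T₂ : H →L[ℂ] H) (i : Fin 3) (e : ℤ) : Prop :=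
  Tendsto (fun k : ℕ => (hilbertFn T₁ T₂ i k : ℝ) / (k : ℝ) ^ 2) atTop (𝓝 (e : ℝ))

/-- `f` agrees with a polynomial at all sufficiently large arguments. -/
def EventuallyPolynomial (f : ℕ → ℕ) : Prop :=
  ∃ p : Polynomial ℝ, ∀ᶠ k : ℕ in atTop, (f k : ℝ) = p.eval (k : ℝ)

end KoszulPair

/-! `T₂` acts on the kernel and on the cokernel of `T₁`. The second homology is the kernel of the
former action, the zeroth is the cokernel of the latter, and the first is an extension of the kernel
of the latter by the cokernel of the former. So a pair is Fredholm exactly when both actions have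
finite dimensional kernel and cokernel (`isFredholm_iff`), and its index is a difference of two
ordinary indices. Additivity of these under composition gives `index_pow_pow`.

For a single such endomorphism `f`, the dimension of `ker (f ^ n)` and the codimension of `range (f
^ n)` are concave in `n`. By the symmetry of the Koszul complex, the outer homology dimensions of
`(T₁ ^ a, T₂ ^ b)` are therefore concave in `a` and in `b`, and they vanish on the axes. Integrality
does the rest (`exists_tendsto_of_biconcave`): for fixed `a` the increments in `b` stabilise at an
integer `r a`, the sequence `r` is again concave, and its own eventual increment is the
multiplicity. The middle homology then follows from the index formula.

The examples are operators on `ℓ²` induced by injections of the index set, where homology is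
computed by counting the points missed by two ranges. -/

section Concave

/-! ### Concave sequences of natural numbers -/

/-- A concave nondecreasing sequence of natural numbers. -/
structure NatConcave (c : ℕ → ℕ) : Prop where
  mono : ∀ n, c n ≤ c (n + 1)
  concave : ∀ n, c n + c (n + 2) ≤ 2 * c (n + 1)

namespace NatConcave

variable {c : ℕ → ℕ}

/-- The increment at `n` is at most each of the `n` earlier ones, whose sum is at most `c n` because
`c 0 ≥ 0`. -/
theorem mul_diff_le (hc : NatConcave c) (n : ℕ) : n * c (n + 1) ≤ (n + 1) * c n := by
  induction n with
  | zero => simp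
  | succ n ih => nlinarith [hc.concave n, hc.mono n]

/-- The ratio `c n / n` is nonincreasing; this supplies the upper bounds in the two-variable limit.
-/
theorem mul_le_mul (hc : NatConcave c) {m n : ℕ} (h : m ≤ n) : m * c n ≤ n * c m := by
  induction n, h using Nat.le_induction with
  | base => exact le_rfl
  | succ n h ih =>
    rcases Nat.eq_zero_or_pos n with rfl | hn
    · obtain rfl : m = 0 := by omega
      simp
    · refine Nat.le_of_mul_le_mul_left ?_ hn
      calc n * (m * c (n + 1)) = m * (n * c (n + 1)) := by ring
        _ ≤ m * ((n + 1) * c n) := Nat.mul_le_mul_left _ (hc.mul_diff_le n)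
        _ = (n + 1) * (m * c n) := by ring
        _ ≤ (n + 1) * (n * c m) := Nat.mul_le_mul_left _ ih
        _ = n * ((n + 1) * c m) := by ring

/-- The increments of a concave nondecreasing sequence of natural numbers are eventually constant,
and bounded below by their eventual value. -/
theorem exists_slope (hc : NatConcave c) :
    ∃ r N : ℕ, (∀ n, c n + r ≤ c (n + 1)) ∧ ∀ n, N ≤ n → c (n + 1) = c n + r := by
  have hanti : Antitone fun n => c (n + 1) - c n := antitone_nat_of_succ_le fun n => by
    have := hc.concave n
    have := hc.mono n
    have := hc.mono (n + 1)
    simp only [add_assoc, one_add_one_eq_two] at *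
    omega
  -- A nonincreasing sequence of naturals stabilises: this is the ascending chain condition in the
  -- order dual.
  obtain ⟨N, hN⟩ := WellFoundedGT.monotone_chain_condition
    ⟨fun n => OrderDual.toDual (c (n + 1) - c n), hanti.dual_right⟩
  have hN' : ∀ n, N ≤ n → c (N + 1) - c N = c (n + 1) - c n := fun n hn =>
    congrArg OrderDual.ofDual (hN n hn)
  refine ⟨c (N + 1) - c N, N, fun n => ?_, fun n hn => ?_⟩
  · have := hc.mono n
    have h1 : c (N + 1) - c N ≤ c (n + 1) - c n := by
      rcases le_total N n with h | h
      · exact (hN' n h).le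
      · exact hanti h
    omega
  · have := hc.mono n
    have := hN' n hn
    omega

/-- A concave nondecreasing sequence of natural numbers has an integral slope at infinity. -/
theorem exists_tendsto (hc : NatConcave c) :
    ∃ r : ℕ, (∀ n, r * n ≤ c n) ∧ Tendsto (fun n : ℕ => (c n : ℝ) / n) atTop (𝓝 r) := by
  obtain ⟨r, N, hlow, hup⟩ := hc.exists_slope
  have hle : ∀ n, r * n ≤ c n := fun n => by
    induction n with
    | zero => simp
    | succ n ih => rw [Nat.mul_succ]; have := hlow n; omega
  refine ⟨r, hle, ?_⟩
  have hval : ∀ n, c (N + n) = c N + r * n := fun n => by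
    induction n with
    | zero => simp
    | succ n ih => rw [← add_assoc, hup _ (by omega), ih]; ring
  have hlim : Tendsto (fun n : ℕ => (r : ℝ) + c N / n) atTop (𝓝 (r + 0)) :=
    tendsto_const_nhds.add (tendsto_const_div_atTop_nhds_zero_nat _)
  rw [add_zero] at hlim
  refine tendsto_of_tendsto_of_tendsto_of_le_of_le' tendsto_const_nhds hlim ?_ ?_
  · filter_upwards [eventually_gt_atTop 0] with n hn
    rw [le_div_iff₀ (by positivity)]
    exact_mod_cast hle n
  · filter_upwards [eventually_gt_atTop 0, eventually_ge_atTop N] with n hn hNn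
    obtain ⟨m, rfl⟩ := Nat.exists_eq_add_of_le hNn
    have hpos : (0 : ℝ) < ((N + m : ℕ) : ℝ) := by exact_mod_cast hn
    rw [div_le_iff₀ hpos, add_mul, div_mul_cancel₀ _ hpos.ne', hval]
    push_cast
    nlinarith [(Nat.cast_nonneg N : (0 : ℝ) ≤ N), (Nat.cast_nonneg r : (0 : ℝ) ≤ r)]

end NatConcave

/-- A function on `ℕ × ℕ` that is concave and nondecreasing in each variable and vanishes on the
axes grows like an integral multiple of `a * b`. -/
theorem exists_tendsto_of_biconcave {h : ℕ → ℕ → ℕ} (h₁ : ∀ b, NatConcave fun a => h a b)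
    (h₂ : ∀ a, NatConcave (h a)) (h0l : ∀ b, h 0 b = 0) (h0r : ∀ a, h a 0 = 0) :
    ∃ e : ℕ, ∀ t s : ℕ, Tendsto (fun k : ℕ => (h (t * k) (s * k) : ℝ) / (k : ℝ) ^ 2) atTop
      (𝓝 ((t : ℝ) * s * e)) := by
  choose r hr hrlim using fun a => (h₂ a).exists_tendsto
  -- Both inequalities hold for `h a n / n` at every `n` and pass to the limit.
  have hrc : NatConcave r := by
    constructor
    · intro a
      have : (r a : ℝ) ≤ r (a + 1) :=
        le_of_tendsto_of_tendsto' (hrlim a) (hrlim (a + 1)) fun n =>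
          div_le_div_of_nonneg_right (by exact_mod_cast (h₁ n).mono a) n.cast_nonneg
      exact_mod_cast this
    · intro a
      have : (r a : ℝ) + r (a + 2) ≤ 2 * r (a + 1) := by
        refine le_of_tendsto_of_tendsto' ((hrlim a).add (hrlim (a + 2)))
          ((hrlim (a + 1)).const_mul 2) fun n => ?_
        rw [← add_div, ← mul_div_assoc]
        exact div_le_div_of_nonneg_right (by exact_mod_cast (h₁ n).concave a) n.cast_nonneg
      exact_mod_cast this
  obtain ⟨e, he, helim⟩ := hrc.exists_tendsto
  have hlow : ∀ a b, e * a * b ≤ h a b := fun a b =>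
    (Nat.mul_le_mul_right _ (he a)).trans (hr a b)
  refine ⟨e, fun t s => ?_⟩
  rcases Nat.eq_zero_or_pos t with rfl | ht
  · simp [h0l]
  rcases Nat.eq_zero_or_pos s with rfl | hs
  · simp [h0r]
  have hts : (0 : ℝ) < (t : ℝ) * s := by positivity
  rw [Metric.tendsto_atTop]
  intro ε hε
  have hδ : 0 < ε / (t * s) := div_pos hε hts
  -- Fix one point `(a, b)` with `h a b < (e + ε / (t * s)) * a * b`. Since `h a b / (a * b)` is
  -- nonincreasing in each variable, the bound persists at `(t * k, s * k)` once these dominate `(a,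
  -- b)`.
  obtain ⟨a, ha, ha0⟩ := ((helim.eventually_lt_const
    (lt_add_of_pos_right (e : ℝ) hδ)).and (eventually_gt_atTop 0)).exists
  have ha0' : (0 : ℝ) < a := by exact_mod_cast ha0
  rw [div_lt_iff₀ ha0'] at ha
  obtain ⟨b, hb, hb0⟩ := (((hrlim a).eventually_lt_const ha).and (eventually_gt_atTop 0)).exists
  have hb0' : (0 : ℝ) < b := by exact_mod_cast hb0
  rw [div_lt_iff₀ hb0'] at hb
  refine ⟨max a b, fun k hk => ?_⟩
  have hak : a ≤ t * k := ((le_max_left _ _).trans hk).trans (Nat.le_mul_of_pos_left k ht)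
  have hbk : b ≤ s * k := ((le_max_right _ _).trans hk).trans (Nat.le_mul_of_pos_left k hs)
  have hk0 : 0 < k := by have := (le_max_left a b).trans hk; omega
  have hk0' : (0 : ℝ) < k := by exact_mod_cast hk0
  have hup : a * b * h (t * k) (s * k) ≤ t * k * (s * k) * h a b := by
    calc a * b * h (t * k) (s * k) = b * (a * h (t * k) (s * k)) := by ring
      _ ≤ b * (t * k * h a (s * k)) := Nat.mul_le_mul_left _ ((h₁ _).mul_le_mul hak)
      _ = t * k * (b * h a (s * k)) := by ring
      _ ≤ t * k * (s * k * h a b) := Nat.mul_le_mul_left _ ((h₂ _).mul_le_mul hbk)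
      _ = _ := by ring
  have hup' : (a : ℝ) * b * h (t * k) (s * k) ≤ t * k * (s * k) * h a b := by exact_mod_cast hup
  have hlow' : (e : ℝ) * (t * k) * (s * k) ≤ h (t * k) (s * k) := by
    exact_mod_cast hlow (t * k) (s * k)
  have hk2 : (0 : ℝ) < (k : ℝ) ^ 2 := by positivity
  rw [Real.dist_eq, abs_sub_lt_iff]
  constructor
  · rw [sub_lt_iff_lt_add, div_lt_iff₀ hk2]
    have hab : (0 : ℝ) < a * b := mul_pos ha0' hb0'
    refine lt_of_mul_lt_mul_left (lt_of_le_of_lt hup' ?_) hab.le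
    have hpos : (0 : ℝ) < t * k * (s * k) := by positivity
    calc (t : ℝ) * k * (s * k) * h a b
        < t * k * (s * k) * ((e + ε / (t * s)) * a * b) := by gcongr
      _ = a * b * ((ε + t * s * e) * k ^ 2) := by field_simp; ring
  · have : (t : ℝ) * s * e ≤ h (t * k) (s * k) / (k : ℝ) ^ 2 := by
      rw [le_div_iff₀ hk2]
      calc (t : ℝ) * s * e * k ^ 2 = e * (t * k) * (s * k) := by ring
        _ ≤ _ := hlow'
    linarith

end Concave

/-! ### Kernels and cokernels of powers of an endomorphism -/

section LinearAlgebra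

open Module

variable {K : Type*} [Field K]

theorem finrank_eq_add_of_exact {A B C : Type*} [AddCommGroup A] [Module K A] [AddCommGroup B]
    [Module K B] [AddCommGroup C] [Module K C] [FiniteDimensional K B] {f : A →ₗ[K] B}
    {g : B →ₗ[K] C} (hf : Function.Injective f) (hfg : Function.Exact f g)
    (hg : Function.Surjective g) : finrank K B = finrank K A + finrank K C := by
  rw [← g.finrank_range_add_finrank_ker, LinearMap.range_eq_top.2 hg, finrank_top,
    hfg.linearMap_ker_eq, LinearMap.finrank_range_of_inj hf, add_comm]

variable {V : Type*} [AddCommGroup V] [Module K V]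

/-- A linear endomorphism with finite dimensional kernel and cokernel. -/
structure LinearMap.FiniteDefect (f : V →ₗ[K] V) : Prop where
  finite_ker : FiniteDimensional K (LinearMap.ker f)
  finite_coker : FiniteDimensional K (V ⧸ LinearMap.range f)

namespace LinearMap.FiniteDefect

variable {f g : V →ₗ[K] V}

theorem mul (hf : FiniteDefect f) (hg : FiniteDefect g) : FiniteDefect (f * g) := by
  have := hf.finite_ker
  have := hg.finite_ker
  have := hf.finite_coker
  have := hg.finite_coker
  constructor
  · rw [Module.End.mul_eq_comp, ker_comp]; infer_instance
  · rw [Module.End.mul_eq_comp, range_comp]; infer_instance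

theorem index_mul (hf : FiniteDefect f) (hg : FiniteDefect g) :
    (f * g).index = f.index + g.index := by
  have := hf.finite_ker
  have := hg.finite_ker
  have := hf.finite_coker
  have := hg.finite_coker
  rw [Module.End.mul_eq_comp, index_comp]

theorem one : FiniteDefect (1 : V →ₗ[K] V) := by
  constructor
  · rw [Module.End.one_eq_id, ker_id]; infer_instance
  · rw [Module.End.one_eq_id, range_id]; infer_instance

theorem pow (hf : FiniteDefect f) (n : ℕ) : FiniteDefect (f ^ n) := by
  induction n with
  | zero => exact one
  | succ n ih => rw [pow_succ]; exact ih.mul hf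

theorem index_pow (hf : FiniteDefect f) (n : ℕ) : (f ^ n).index = n * f.index := by
  induction n with
  | zero => simp [Module.End.one_eq_id]
  | succ n ih => rw [pow_succ, (hf.pow n).index_mul hf, ih]; push_cast; ring

theorem of_finiteDimensional [FiniteDimensional K V] (f : V →ₗ[K] V) : FiniteDefect f :=
  ⟨inferInstance, inferInstance⟩

/-- Applying `g` maps `ker (f * g)` onto `ker f ⊓ range g` with kernel `ker g`. -/
theorem finrank_ker_mul (hf : FiniteDefect f) (hg : FiniteDefect g) :
    finrank K (ker (f * g)) = finrank K (ker g) + finrank K (ker f ⊓ range g : Submodule K V) := by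
  have := (hf.mul hg).finite_ker
  let q : ker (f * g) →ₗ[K] (ker f ⊓ range g : Submodule K V) :=
    g.restrict fun x hx => ⟨by simpa using hx, mem_range_self g x⟩
  refine finrank_eq_add_of_exact (f := Submodule.inclusion (ker_le_ker_comp g f)) (g := q)
    (Submodule.inclusion_injective _) ?_ ?_
  · rw [exact_iff]
    rw [Submodule.range_inclusion]
    ext x
    simp only [mem_ker, Submodule.mem_comap, q]
    exact Subtype.ext_iff
  · rintro ⟨_, hx, y, rfl⟩
    exact ⟨⟨y, by simpa using hx⟩, rfl⟩

/-- Applying `f` embeds `V ⧸ range g ⊔ ker f` into `V ⧸ range (f * g)`, with quotient `V ⧸ range f`.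
-/
theorem finrank_coker_mul (hf : FiniteDefect f) (hg : FiniteDefect g) :
    finrank K (V ⧸ range (f * g)) = finrank K (V ⧸ range f) + finrank K (V ⧸ range g ⊔ ker f) := by
  have := (hf.mul hg).finite_coker
  have hle : range g ⊔ ker f ≤ (range (f * g)).comap f := by
    rw [Module.End.mul_eq_comp, range_comp, Submodule.comap_map_eq]
  have hle' : range (f * g) ≤ range f := range_comp_le_range g f
  rw [add_comm]
  refine finrank_eq_add_of_exact (f := Submodule.mapQ _ _ f hle) (g := Submodule.factor hle')
    ?_ ?_ (Submodule.factor_surjective _)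
  · rw [← ker_eq_bot, Submodule.ker_mapQ, Module.End.mul_eq_comp, range_comp,
      Submodule.comap_map_eq, Submodule.mkQ_map_self]
  · rw [exact_iff]
    simp [Submodule.factor, Submodule.ker_mapQ, Submodule.range_mapQ]

/-- The increment at `n` is the dimension of `ker f ⊓ range (f ^ n)`, which shrinks as `n` grows. -/
theorem natConcave_finrank_ker_pow (hf : FiniteDefect f) :
    NatConcave fun n => finrank K (ker (f ^ n)) := by
  have key : ∀ n, finrank K (ker (f ^ (n + 1))) =
      finrank K (ker (f ^ n)) + finrank K (ker f ⊓ range (f ^ n) : Submodule K V) := fun n => by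
    rw [pow_succ', hf.finrank_ker_mul (hf.pow n)]
  refine ⟨fun n => by simp only [key]; omega, fun n => ?_⟩
  have := hf.finite_ker
  have hle : finrank K (ker f ⊓ range (f ^ (n + 1)) : Submodule K V) ≤
      finrank K (ker f ⊓ range (f ^ n) : Submodule K V) := by
    refine Submodule.finrank_mono (inf_le_inf_left _ ?_)
    rw [pow_succ]
    exact range_comp_le_range _ _
  simp only [key (n + 1), key n] at *
  omega

/-- The increment at `n` is the codimension of `range f ⊔ ker (f ^ n)`, a subspace that grows with
`n`. -/
theorem natConcave_finrank_coker_pow (hf : FiniteDefect f) :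
    NatConcave fun n => finrank K (V ⧸ range (f ^ n)) := by
  have key : ∀ n, finrank K (V ⧸ range (f ^ (n + 1))) =
      finrank K (V ⧸ range (f ^ n)) + finrank K (V ⧸ range f ⊔ ker (f ^ n)) := fun n => by
    rw [pow_succ, (hf.pow n).finrank_coker_mul hf]
  refine ⟨fun n => by simp only [key]; omega, fun n => ?_⟩
  have hfin := hf.finite_coker
  have hle : finrank K (V ⧸ range f ⊔ ker (f ^ (n + 1))) ≤
      finrank K (V ⧸ range f ⊔ ker (f ^ n)) := by
    have : FiniteDimensional K (V ⧸ range f ⊔ ker (f ^ n)) :=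
      Module.Finite.of_surjective (Submodule.factor le_sup_left)
        (Submodule.factor_surjective (p := range f) _)
    have hle : range f ⊔ ker (f ^ n) ≤ range f ⊔ ker (f ^ (n + 1)) := by
      refine sup_le_sup_left ?_ _
      rw [pow_succ']
      exact ker_le_ker_comp _ _
    exact finrank_le_finrank_of_surjective (Submodule.factor_surjective hle)
  simp only [key (n + 1), key n] at *
  omega

end LinearMap.FiniteDefect

end LinearAlgebra

/-! ### Koszul homology through the kernel and cokernel of `T₁` -/

namespace KoszulPair

open Module LinearMap

variable {H : Type u} [NormedAddCommGroup H] [InnerProductSpace ℂ H] {T₁ T₂ : H →L[ℂ] H}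

theorem commute_apply (hT : Commute T₁ T₂) (x : H) : T₁ (T₂ x) = T₂ (T₁ x) :=
  congrArg (fun S : H →L[ℂ] H => S x) hT.eq

theorem ker_le_comap (hT : Commute T₁ T₂) :
    ∀ x ∈ ker (T₁ : H →ₗ[ℂ] H), (T₂ : H →ₗ[ℂ] H) x ∈ ker (T₁ : H →ₗ[ℂ] H) := fun x hx => by
  have hx : T₁ x = 0 := hx
  change T₁ (T₂ x) = 0
  rw [commute_apply hT, hx, map_zero]

theorem range_le_comap (hT : Commute T₁ T₂) :
    range (T₁ : H →ₗ[ℂ] H) ≤ (range (T₁ : H →ₗ[ℂ] H)).comap (T₂ : H →ₗ[ℂ] H) := by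
  rintro _ ⟨x, rfl⟩
  exact ⟨T₂ x, commute_apply hT x⟩

/-- The action of `T₂` on the kernel of `T₁`. -/
def onKer (hT : Commute T₁ T₂) : ker (T₁ : H →ₗ[ℂ] H) →ₗ[ℂ] ker (T₁ : H →ₗ[ℂ] H) :=
  (T₂ : H →ₗ[ℂ] H).restrict (ker_le_comap hT)

/-- The action of `T₂` on the cokernel of `T₁`. -/
def onCoker (hT : Commute T₁ T₂) :
    (H ⧸ range (T₁ : H →ₗ[ℂ] H)) →ₗ[ℂ] H ⧸ range (T₁ : H →ₗ[ℂ] H) :=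
  Submodule.mapQ _ _ (T₂ : H →ₗ[ℂ] H) (range_le_comap hT)

theorem onKer_pow (hT : Commute T₁ T₂) (n : ℕ) : onKer (hT.pow_right n) = onKer hT ^ n := by
  rw [onKer, onKer, Module.End.pow_restrict]
  simp only [ContinuousLinearMap.toLinearMap_pow]

theorem onCoker_pow (hT : Commute T₁ T₂) (n : ℕ) : onCoker (hT.pow_right n) = onCoker hT ^ n := by
  rw [onCoker, onCoker, ← Submodule.mapQ_pow]
  simp only [ContinuousLinearMap.toLinearMap_pow]

/-- `H₂` is the kernel of `T₂` on the kernel of `T₁`. -/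
def H₂Equiv (hT : Commute T₁ T₂) : H₂ T₁ T₂ ≃ₗ[ℂ] ker (onKer hT) where
  toFun x := ⟨⟨x, (Prod.mk.inj x.2).2⟩, Subtype.ext (neg_eq_zero.1 (Prod.mk.inj x.2).1)⟩
  invFun x := ⟨x, Prod.ext (neg_eq_zero.2 (congrArg Subtype.val x.2)) x.1.2⟩
  map_add' _ _ := rfl
  map_smul' _ _ := rfl
  left_inv _ := rfl
  right_inv _ := rfl

/-- `H₀` is the cokernel of `T₂` on the cokernel of `T₁`. -/
noncomputable def H₀Equiv (hT : Commute T₁ T₂) :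
    H₀ T₁ T₂ ≃ₗ[ℂ] (H ⧸ range (T₁ : H →ₗ[ℂ] H)) ⧸ range (onCoker hT) :=
  Submodule.quotEquivOfEq _ _ (range_coprod _ _) ≪≫ₗ
    (Submodule.quotientQuotientEquivQuotientSup _ _).symm ≪≫ₗ
    Submodule.quotEquivOfEq _ _ (Submodule.range_mapQ _ _ _ _).symm

/-- The inclusion `a ↦ (a, 0)` of the kernel of `T₁` into the one-cycles. -/
def kerInl (T₁ T₂ : H →L[ℂ] H) : ker (T₁ : H →ₗ[ℂ] H) →ₗ[ℂ] ker (d₁ T₁ T₂) :=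
  (LinearMap.inl ℂ H H).restrict fun a ha => by
    have ha : T₁ a = 0 := ha
    simp [d₁_apply, ha]

theorem coe_kerInl (a : ker (T₁ : H →ₗ[ℂ] H)) : (kerInl T₁ T₂ a : H × H) = ((a : H), 0) := rfl

theorem coe_onKer (hT : Commute T₁ T₂) (a : ker (T₁ : H →ₗ[ℂ] H)) : (onKer hT a : H) = T₂ a := rfl

/-- The map from the cokernel of `T₂` on the kernel of `T₁` to `H₁`. -/
def toH₁ (hT : Commute T₁ T₂) : (ker (T₁ : H →ₗ[ℂ] H) ⧸ range (onKer hT)) →ₗ[ℂ] H₁ T₁ T₂ :=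
  Submodule.mapQ _ _ (kerInl T₁ T₂) <| by
    rintro _ ⟨x, rfl⟩
    refine ⟨-x, Prod.ext ?_ ?_⟩
    · simp [d₂_apply, coe_kerInl, coe_onKer]
    · have hx : T₁ (x : H) = 0 := x.2
      simp [d₂_apply, coe_kerInl, hx]

/-- The map `(u, v) ↦ v` from `H₁` to the cokernel of `T₁`. -/
def fromH₁ (T₁ T₂ : H →L[ℂ] H) : H₁ T₁ T₂ →ₗ[ℂ] H ⧸ range (T₁ : H →ₗ[ℂ] H) :=
  Submodule.mapQ _ _ (LinearMap.snd ℂ H H ∘ₗ (ker (d₁ T₁ T₂)).subtype) <| by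
    rintro x ⟨w, hw⟩
    exact ⟨w, congrArg Prod.snd hw⟩

theorem toH₁_injective (hT : Commute T₁ T₂) : Function.Injective (toH₁ hT) := by
  rw [← ker_eq_bot, toH₁, Submodule.ker_mapQ, eq_bot_iff, Submodule.map_le_iff_le_comap,
    Submodule.comap_bot, Submodule.ker_mkQ]
  rintro a ⟨w, hw⟩
  have hw1 : -T₂ w = a := congrArg Prod.fst hw
  have hw2 : T₁ w = 0 := congrArg Prod.snd hw
  exact ⟨⟨-w, by simpa using hw2⟩, Subtype.ext (by simpa [coe_onKer] using hw1)⟩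

theorem exact_toH₁_fromH₁ (hT : Commute T₁ T₂) : Function.Exact (toH₁ hT) (fromH₁ T₁ T₂) := by
  rw [exact_iff, toH₁, fromH₁, Submodule.ker_mapQ, Submodule.range_mapQ]
  apply le_antisymm
  · rw [Submodule.map_le_iff_le_comap]
    rintro ⟨⟨u, v⟩, huv⟩ ⟨w, hw⟩
    have huv : T₁ u + T₂ v = 0 := huv
    have hw : T₁ w = v := hw
    -- Subtracting the boundary of `w` from the cycle `(u, T₁ w)` leaves `(u + T₂ w, 0)`, which
    -- comes from `ker T₁`.
    have hmem : T₁ (u + T₂ w) = 0 := by rw [map_add, commute_apply hT, hw, huv]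
    refine ⟨kerInl T₁ T₂ ⟨u + T₂ w, hmem⟩, ⟨_, rfl⟩, ?_⟩
    rw [← sub_eq_zero, ← map_sub, Submodule.mkQ_apply, Submodule.Quotient.mk_eq_zero]
    refine ⟨-w, Prod.ext ?_ ?_⟩
    · simp [d₂_apply, coe_kerInl]
    · simp [d₂_apply, coe_kerInl, hw]
  · refine Submodule.map_mono ?_
    rintro _ ⟨a, rfl⟩
    exact ⟨0, by simp [coe_kerInl]⟩

/-- A vector `v` completes to a cycle `(u, v)` exactly when `T₂ v` lies in the range of `T₁`. This
finishes the description of `H₁` as an extension. -/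
theorem range_fromH₁ (hT : Commute T₁ T₂) : range (fromH₁ T₁ T₂) = ker (onCoker hT) := by
  rw [fromH₁, onCoker, Submodule.ker_mapQ, Submodule.range_mapQ]
  congr 1
  ext v
  constructor
  · rintro ⟨⟨⟨u, v⟩, huv⟩, rfl⟩
    have huv : T₁ u + T₂ v = 0 := huv
    exact ⟨-u, by simpa [neg_eq_iff_add_eq_zero] using huv⟩
  · rintro ⟨u, hu⟩
    have hu : T₁ u = T₂ v := hu
    exact ⟨⟨(-u, v), by simp [d₁_apply, hu]⟩, rfl⟩

theorem isFredholm_iff (hT : Commute T₁ T₂) :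
    IsFredholm T₁ T₂ ↔ (onKer hT).FiniteDefect ∧ (onCoker hT).FiniteDefect := by
  constructor
  · rintro ⟨h0, h1, h2⟩
    refine ⟨⟨(H₂Equiv hT).finiteDimensional, .of_injective _ (toH₁_injective hT)⟩, ⟨?_,
      (H₀Equiv hT).finiteDimensional⟩⟩
    rw [← range_fromH₁ hT]
    infer_instance
  · rintro ⟨⟨_, _⟩, ⟨_, _⟩⟩
    refine ⟨(H₀Equiv hT).symm.finiteDimensional, ?_, (H₂Equiv hT).symm.finiteDimensional⟩
    have : FiniteDimensional ℂ (range (fromH₁ T₁ T₂)) := by rwa [range_fromH₁ hT]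
    refine Module.Finite.of_exact (f := toH₁ hT) (g := (fromH₁ T₁ T₂).rangeRestrict) ?_
      (surjective_rangeRestrict _)
    rw [exact_iff, ker_rangeRestrict]
    exact (exact_toH₁_fromH₁ hT).linearMap_ker_eq

theorem dimH_zero (hT : Commute T₁ T₂) :
    dimH T₁ T₂ 0 = finrank ℂ ((H ⧸ range (T₁ : H →ₗ[ℂ] H)) ⧸ range (onCoker hT)) :=
  (H₀Equiv hT).finrank_eq

theorem dimH_two (hT : Commute T₁ T₂) : dimH T₁ T₂ 2 = finrank ℂ (ker (onKer hT)) :=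
  (H₂Equiv hT).finrank_eq

theorem dimH_one (hT : Commute T₁ T₂) (hF : IsFredholm T₁ T₂) :
    dimH T₁ T₂ 1 = finrank ℂ (ker (T₁ : H →ₗ[ℂ] H) ⧸ range (onKer hT)) +
      finrank ℂ (ker (onCoker hT)) := by
  have := hF.finite_H₁
  rw [← range_fromH₁ hT]
  refine finrank_eq_add_of_exact (f := toH₁ hT) (g := (fromH₁ T₁ T₂).rangeRestrict)
    (toH₁_injective hT) ?_ (surjective_rangeRestrict _)
  rw [exact_iff, ker_rangeRestrict]
  exact (exact_toH₁_fromH₁ hT).linearMap_ker_eq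

theorem index_eq_sub (hT : Commute T₁ T₂) (hF : IsFredholm T₁ T₂) :
    index T₁ T₂ = (onKer hT).index - (onCoker hT).index := by
  rw [index, dimH_zero hT, dimH_one hT hF, dimH_two hT, LinearMap.index_eq_finrank_sub,
    LinearMap.index_eq_finrank_sub]
  push_cast
  ring

/-! ### Symmetry, powers and multiplicities -/

/-- Exchanging the operators exchanges the coordinates of the one-cycles. -/
def cyclesSwap (T₁ T₂ : H →L[ℂ] H) : ker (d₁ T₁ T₂) ≃ₗ[ℂ] ker (d₁ T₂ T₁) where
  toFun x := ⟨x.1.swap, (add_comm _ _).trans x.2⟩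
  invFun x := ⟨x.1.swap, (add_comm _ _).trans x.2⟩
  map_add' _ _ := rfl
  map_smul' _ _ := rfl
  left_inv _ := rfl
  right_inv _ := rfl

/-- `H₁` is symmetric in the two operators. -/
noncomputable def H₁Swap (T₁ T₂ : H →L[ℂ] H) : H₁ T₁ T₂ ≃ₗ[ℂ] H₁ T₂ T₁ :=
  Submodule.Quotient.equiv _ _ (cyclesSwap T₁ T₂) <| by
    ext ⟨⟨u, v⟩, huv⟩
    constructor
    · rintro ⟨⟨⟨v', u'⟩, h'⟩, ⟨w, hw⟩, h⟩
      obtain ⟨rfl, rfl⟩ := Prod.mk.inj (congrArg Subtype.val h)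
      obtain ⟨h1, h2⟩ := Prod.mk.inj hw
      refine ⟨-w, Prod.ext ?_ ?_⟩
      · simpa [d₂_apply] using! h2
      · simpa [d₂_apply] using! h1
    · rintro ⟨w, hw⟩
      obtain ⟨h1, h2⟩ := Prod.mk.inj hw
      refine ⟨(cyclesSwap T₁ T₂).symm ⟨(u, v), huv⟩, ⟨-w, Prod.ext ?_ ?_⟩, rfl⟩
      · simpa [d₂_apply] using! h2
      · simpa [d₂_apply] using! h1

/-- `H₀` is symmetric in the two operators. -/
noncomputable def H₀Swap (T₁ T₂ : H →L[ℂ] H) : H₀ T₁ T₂ ≃ₗ[ℂ] H₀ T₂ T₁ :=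
  Submodule.quotEquivOfEq _ _ <| by rw [d₁, d₁, range_coprod, range_coprod, sup_comm]

/-- `H₂` is symmetric in the two operators. -/
noncomputable def H₂Swap (T₁ T₂ : H →L[ℂ] H) : H₂ T₁ T₂ ≃ₗ[ℂ] H₂ T₂ T₁ :=
  LinearEquiv.ofEq _ _ <| by
    ext x
    simp [d₂_apply, and_comm]

theorem IsFredholm.swap (hF : IsFredholm T₁ T₂) : IsFredholm T₂ T₁ := by
  obtain ⟨_, _, _⟩ := hF
  exact ⟨(H₀Swap T₁ T₂).finiteDimensional, (H₁Swap T₁ T₂).finiteDimensional,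
    (H₂Swap T₁ T₂).finiteDimensional⟩

theorem dimH_swap (T₁ T₂ : H →L[ℂ] H) (i : Fin 3) : dimH T₁ T₂ i = dimH T₂ T₁ i := by
  fin_cases i
  · exact (H₀Swap T₁ T₂).finrank_eq
  · exact (H₁Swap T₁ T₂).finrank_eq
  · exact (H₂Swap T₁ T₂).finrank_eq

theorem IsFredholm.pow_right (hT : Commute T₁ T₂) (hF : IsFredholm T₁ T₂) (n : ℕ) :
    IsFredholm T₁ (T₂ ^ n) := by
  obtain ⟨h1, h2⟩ := (isFredholm_iff hT).1 hF
  refine (isFredholm_iff (hT.pow_right n)).2 ⟨?_, ?_⟩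
  · rw [onKer_pow]; exact h1.pow n
  · rw [onCoker_pow]; exact h2.pow n

theorem index_pow_right (hT : Commute T₁ T₂) (hF : IsFredholm T₁ T₂) (n : ℕ) :
    index T₁ (T₂ ^ n) = n * index T₁ T₂ := by
  obtain ⟨h1, h2⟩ := (isFredholm_iff hT).1 hF
  rw [index_eq_sub (hT.pow_right n) (hF.pow_right hT n), index_eq_sub hT hF, onKer_pow hT,
    onCoker_pow hT, h1.index_pow, h2.index_pow, mul_sub]

theorem index_swap (T₁ T₂ : H →L[ℂ] H) : index T₁ T₂ = index T₂ T₁ := by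
  simp only [index, dimH_swap T₁ T₂]

theorem IsFredholm.pow_left (hT : Commute T₁ T₂) (hF : IsFredholm T₁ T₂) (n : ℕ) :
    IsFredholm (T₁ ^ n) T₂ :=
  (hF.swap.pow_right hT.symm n).swap

theorem IsFredholm.pow_pow (hT : Commute T₁ T₂) (hF : IsFredholm T₁ T₂) (a b : ℕ) :
    IsFredholm (T₁ ^ a) (T₂ ^ b) :=
  (hF.pow_left hT a).pow_right (hT.pow_left a) b

theorem index_pow_pow (hT : Commute T₁ T₂) (hF : IsFredholm T₁ T₂) (a b : ℕ) :
    index (T₁ ^ a) (T₂ ^ b) = a * b * index T₁ T₂ := by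
  rw [index_pow_right (hT.pow_left a) (hF.pow_left hT a), index_swap,
    index_pow_right hT.symm hF.swap, index_swap T₂ T₁]
  ring

theorem natConcave_dimH_zero (hT : Commute T₁ T₂) (hF : IsFredholm T₁ T₂) :
    NatConcave fun n => dimH T₁ (T₂ ^ n) 0 := by
  have key : ∀ n, dimH T₁ (T₂ ^ n) 0 =
      finrank ℂ ((H ⧸ range (T₁ : H →ₗ[ℂ] H)) ⧸ range (onCoker hT ^ n)) := fun n => by
    rw [dimH_zero (hT.pow_right n), onCoker_pow hT]
  simp only [key]
  exact ((isFredholm_iff hT).1 hF).2.natConcave_finrank_coker_pow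

theorem natConcave_dimH_two (hT : Commute T₁ T₂) (hF : IsFredholm T₁ T₂) :
    NatConcave fun n => dimH T₁ (T₂ ^ n) 2 := by
  have key : ∀ n, dimH T₁ (T₂ ^ n) 2 = finrank ℂ (LinearMap.ker (onKer hT ^ n)) := fun n => by
    rw [dimH_two (hT.pow_right n), onKer_pow hT]
  simp only [key]
  exact ((isFredholm_iff hT).1 hF).1.natConcave_finrank_ker_pow

/-- A zeroth power is the identity, so this gives vanishing on the axes. -/
theorem dimH_one_right_zero (T : H →L[ℂ] H) : dimH T 1 0 = 0 := by
  have : Subsingleton (H₀ T 1) := by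
    rw [Submodule.Quotient.subsingleton_iff, range_eq_top]
    exact fun x => ⟨(0, x), by simp [d₁_apply]⟩
  exact finrank_zero_of_subsingleton

theorem dimH_one_right_two (T : H →L[ℂ] H) : dimH T 1 2 = 0 := by
  have : Subsingleton (H₂ T 1) := ⟨fun x y => Subtype.ext <| by
    exact (neg_eq_zero.1 (Prod.mk.inj x.2).1).trans (neg_eq_zero.1 (Prod.mk.inj y.2).1).symm⟩
  exact finrank_zero_of_subsingleton

/-- Concavity is assumed in the second exponent only, but for all pairs; exchanging the operators
gives it in the first. -/
theorem exists_tendsto_dimH {i : Fin 3} (hT : Commute T₁ T₂) (hF : IsFredholm T₁ T₂)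
    (hc : ∀ {S₁ S₂ : H →L[ℂ] H}, Commute S₁ S₂ → IsFredholm S₁ S₂ →
      NatConcave fun n => dimH S₁ (S₂ ^ n) i)
    (h0 : ∀ S : H →L[ℂ] H, dimH S 1 i = 0) :
    ∃ e : ℕ, ∀ t s : ℕ, Tendsto (fun k : ℕ => (dimH (T₁ ^ (t * k)) (T₂ ^ (s * k)) i : ℝ) /
      (k : ℝ) ^ 2) atTop (𝓝 ((t : ℝ) * s * e)) := by
  refine exists_tendsto_of_biconcave (h := fun a b => dimH (T₁ ^ a) (T₂ ^ b) i) (fun b => ?_)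
    (fun a => hc (hT.pow_left a) (hF.pow_left hT a)) (fun b => ?_) (fun a => ?_)
  · simp only [dimH_swap _ (T₂ ^ b)]
    exact hc (hT.symm.pow_left b) (hF.swap.pow_left hT.symm b)
  · simp only [dimH_swap _ (T₂ ^ b), pow_zero, h0]
  · simp only [pow_zero, h0]

/-- The homological Hilbert functions of a Fredholm pair grow like integral multiples of the
product of the exponents. -/
theorem exists_multiplicities (hT : Commute T₁ T₂) (hF : IsFredholm T₁ T₂) :
    ∃ e : Fin 3 → ℤ, index T₁ T₂ = e 2 - e 1 + e 0 ∧ ∀ (t s : ℕ) (i : Fin 3),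
      HasMultiplicity (T₁ ^ t) (T₂ ^ s) i ((t : ℤ) * (s : ℤ) * e i) := by
  obtain ⟨e₀, h₀⟩ := exists_tendsto_dimH hT hF natConcave_dimH_zero dimH_one_right_zero
  obtain ⟨e₂, h₂⟩ := exists_tendsto_dimH hT hF natConcave_dimH_two dimH_one_right_two
  -- The middle entry is forced by the index formula.
  refine ⟨![e₀, e₂ + e₀ - index T₁ T₂, e₂], ?_, fun t s i => ?_⟩
  · simp; ring
  · simp only [HasMultiplicity, hilbertFn, ← pow_mul]
    fin_cases i
    · simpa using h₀ t s
    · have hlim := ((h₂ t s).add (h₀ t s)).sub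
        (tendsto_const_nhds (x := (t : ℝ) * s * (index T₁ T₂ : ℝ)))
      have hval : (t : ℝ) * s * e₂ + t * s * e₀ - t * s * (index T₁ T₂ : ℝ) =
          (((t : ℤ) * (s : ℤ) * (e₂ + e₀ - index T₁ T₂) : ℤ) : ℝ) := by
        push_cast; ring
      rw [hval] at hlim
      refine hlim.congr' ?_
      filter_upwards [eventually_gt_atTop 0] with k hk
      have hk : (k : ℝ) ≠ 0 := by exact_mod_cast hk.ne'
      have hidx := index_pow_pow hT hF (t * k) (s * k)
      have hdef : (index (T₁ ^ (t * k)) (T₂ ^ (s * k)) : ℝ) =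
          dimH (T₁ ^ (t * k)) (T₂ ^ (s * k)) 2 - dimH (T₁ ^ (t * k)) (T₂ ^ (s * k)) 1 +
            dimH (T₁ ^ (t * k)) (T₂ ^ (s * k)) 0 := by
        rw [index]; push_cast; ring
      rw [hidx] at hdef
      push_cast at hdef
      simp only [Fin.mk_one]
      field_simp
      linear_combination -hdef
    · simpa using h₂ t s

end KoszulPair

namespace KoszulPair

open Module LinearMap

/-! ### Operators on `ℓ²` induced by injections -/

section SquareSummable

variable {ι : Type}

/-- Square summable families of complex numbers. -/
abbrev SqSum (ι : Type) : Type := lp (fun _ : ι => ℂ) 2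

theorem SqSum.summable (u : SqSum ι) : Summable fun i => ‖u i‖ ^ (2 : ENNReal).toReal :=
  (memℓp_gen_iff (by simp)).1 (lp.memℓp u)

theorem norm_extend_zero (f : ι → ι) (u : ι → ℂ) :
    (fun i => ‖Function.extend f u 0 i‖ ^ (2 : ENNReal).toReal) =
      Function.extend f (fun i => ‖u i‖ ^ (2 : ENNReal).toReal) 0 := by
  classical
  funext i
  simp only [Function.extend_def]
  split_ifs <;> simp

/-- Composition with an injective map, as an operator on square summable families. -/
noncomputable def pull (f : ι → ι) (hf : f.Injective) : SqSum ι →L[ℂ] SqSum ι :=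
  LinearMap.mkContinuous
    { toFun := fun u => ⟨fun n => u (f n),
        (memℓp_gen_iff (by simp)).2 (u.summable.comp_injective hf)⟩
      map_add' := fun _ _ => rfl
      map_smul' := fun _ _ => rfl } 1 fun u => by
    rw [one_mul]
    refine lp.norm_le_of_tsum_le (by simp) (norm_nonneg _) ?_
    rw [lp.norm_rpow_eq_tsum (by simp)]
    exact Summable.tsum_le_tsum_of_inj f hf (fun _ _ => by positivity) (fun _ => le_rfl)
      (u.summable.comp_injective hf) u.summable

/-- Extension by zero along an injective map, as an operator on square summable families. -/
noncomputable def push (f : ι → ι) (hf : f.Injective) : SqSum ι →L[ℂ] SqSum ι :=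
  LinearMap.mkContinuous
    { toFun := fun u => ⟨Function.extend f u 0, (memℓp_gen_iff (by simp)).2 (by
        rw [norm_extend_zero]
        exact (summable_extend_zero hf).2 u.summable)⟩
      map_add' := fun u v => by
        ext i
        change Function.extend f (u + v : ι → ℂ) 0 i =
          Function.extend f u 0 i + Function.extend f v 0 i
        by_cases h : ∃ n, f n = i
        · obtain ⟨n, rfl⟩ := h
          simp [hf.extend_apply]
        · simp [Function.extend_apply' _ _ _ h]
      map_smul' := fun c u => by
        ext i
        by_cases h : ∃ n, f n = i
        · obtain ⟨n, rfl⟩ := h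
          simp [hf.extend_apply]
        · simp [Function.extend_apply' _ _ _ h] } 1 fun u => by
    rw [one_mul]
    refine lp.norm_le_of_tsum_le (by simp) (norm_nonneg _) ?_
    rw [lp.norm_rpow_eq_tsum (by simp)]
    simp only [coe_mk, AddHom.coe_mk, norm_extend_zero]
    exact (tsum_extend_zero hf _).le

variable {f g : ι → ι} {hf : f.Injective} {hg : g.Injective}

@[simp]
theorem pull_apply (u : SqSum ι) (n : ι) : pull f hf u n = u (f n) := rfl

@[simp]
theorem push_apply (u : SqSum ι) (n : ι) : push f hf u (f n) = u n := hf.extend_apply _ _ _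

theorem push_apply_of_notMem (u : SqSum ι) {m : ι} (hm : m ∉ Set.range f) : push f hf u m = 0 :=
  Function.extend_apply' _ _ _ hm

theorem pull_push (u : SqSum ι) : pull f hf (push f hf u) = u := by
  ext n
  simp

theorem push_pull {u : SqSum ι} (hu : ∀ m ∉ Set.range f, u m = 0) :
    push f hf (pull f hf u) = u := by
  ext m
  by_cases hm : m ∈ Set.range f
  · obtain ⟨n, rfl⟩ := hm
    simp
  · rw [push_apply_of_notMem _ hm, hu m hm]

theorem push_injective : Function.Injective (push f hf) :=
  Function.LeftInverse.injective pull_push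

theorem pull_surjective : Function.Surjective (pull f hf) :=
  Function.RightInverse.surjective pull_push

theorem mem_range_push {u : SqSum ι} :
    u ∈ range (push f hf : SqSum ι →ₗ[ℂ] SqSum ι) ↔ ∀ m ∉ Set.range f, u m = 0 := by
  constructor
  · rintro ⟨v, rfl⟩ m hm
    exact push_apply_of_notMem v hm
  · exact fun hu => ⟨_, push_pull hu⟩

theorem pull_pow (k : ℕ) : pull f hf ^ k = pull f^[k] (hf.iterate k) := by
  induction k with
  | zero => rfl
  | succ k ih =>
    rw [pow_succ', ih]
    ext u n
    rfl

theorem push_push (u : SqSum ι) :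
    push f hf (push g hg u) = push (f ∘ g) (hf.comp hg) u := by
  ext m
  by_cases hm : m ∈ Set.range f
  · obtain ⟨n, rfl⟩ := hm
    rw [push_apply]
    by_cases hn : n ∈ Set.range g
    · obtain ⟨l, rfl⟩ := hn
      exact (push_apply u l).trans (push_apply (hf := hf.comp hg) u l).symm
    · rw [push_apply_of_notMem _ hn, push_apply_of_notMem]
      rintro ⟨l, hl⟩
      exact hn ⟨l, hf hl⟩
  · rw [push_apply_of_notMem _ hm, push_apply_of_notMem]
    rintro ⟨l, hl⟩
    exact hm ⟨_, hl⟩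

theorem push_pow (k : ℕ) : push f hf ^ k = push f^[k] (hf.iterate k) := by
  induction k with
  | zero =>
    ext u n
    exact (push_apply (f := id) (hf := Function.injective_id) u n).symm
  | succ k ih =>
    rw [pow_succ, ih]
    ext u : 1
    exact push_push (hf := hf.iterate k) u

theorem commute_pull (h : Function.Commute f g) : Commute (pull f hf) (pull g hg) := by
  ext u n
  exact congrArg u (h n).symm

theorem commute_push (h : Function.Commute f g) : Commute (push f hf) (push g hg) := by
  ext u : 1
  have h' : f ∘ g = g ∘ f := funext h
  change push f hf (push g hg u) = push g hg (push f hf u)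
  rw [push_push, push_push]
  congr 2

/-- If `f` and `g` commute and `g` reflects the range of `f`, then extension along `f` commutes
with composition with `g`. -/
theorem commute_push_pull (h : Function.Commute f g)
    (hfg : ∀ m, g m ∈ Set.range f → m ∈ Set.range f) : Commute (push f hf) (pull g hg) := by
  ext u n
  change push f hf (pull g hg u) n = push f hf u (g n)
  by_cases hn : n ∈ Set.range f
  · obtain ⟨m, rfl⟩ := hn
    rw [push_apply, pull_apply, ← h m, push_apply]
  · rw [push_apply_of_notMem _ hn, push_apply_of_notMem _ fun h => hn (hfg n h)]

/-- Restriction of square summable families to a subset. -/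
def restr (S : Set ι) : SqSum ι →ₗ[ℂ] S → ℂ where
  toFun u i := u i
  map_add' _ _ := rfl
  map_smul' _ _ := rfl

theorem exists_extension {S : Set ι} (hS : S.Finite) (v : S → ℂ) :
    ∃ u : SqSum ι, restr S u = v ∧ ∀ m ∉ S, u m = 0 := by
  have h0 : ∀ m ∉ S, Function.extend Subtype.val v 0 m = 0 := fun m hm =>
    Function.extend_apply' _ _ _ fun ⟨i, hi⟩ => hm (hi ▸ i.2)
  refine ⟨⟨Function.extend Subtype.val v 0, (memℓp_gen_iff (by simp)).2 ?_⟩, ?_, h0⟩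
  · exact summable_of_hasFiniteSupport (hS.subset fun m hm => by
      by_contra h
      exact hm (by simp [h0 m h]))
  · ext i
    exact Subtype.val_injective.extend_apply _ _ _

theorem finiteDimensional_coker_push (hS : (Set.range f)ᶜ.Finite) :
    FiniteDimensional ℂ (SqSum ι ⧸ range (push f hf : SqSum ι →ₗ[ℂ] SqSum ι)) := by
  have := hS.to_subtype
  have hker : LinearMap.ker (restr (Set.range f)ᶜ) =
      range (push f hf : SqSum ι →ₗ[ℂ] SqSum ι) := by
    ext u
    rw [mem_range_push]
    exact ⟨fun h m hm => congrFun h ⟨m, hm⟩, fun h => funext fun m => h m m.2⟩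
  rw [← hker]
  exact (quotKerEquivRange _).symm.finiteDimensional

theorem finiteDimensional_ker_pull (hS : (Set.range f)ᶜ.Finite) :
    FiniteDimensional ℂ (LinearMap.ker (pull f hf : SqSum ι →ₗ[ℂ] SqSum ι)) := by
  have := hS.to_subtype
  refine .of_injective ((restr (Set.range f)ᶜ).domRestrict _) ?_
  rw [injective_iff_map_eq_zero]
  rintro ⟨u, hu⟩ h
  refine Subtype.ext (lp.ext (funext fun m => ?_))
  by_cases hm : m ∈ Set.range f
  · obtain ⟨n, rfl⟩ := hm
    exact congrArg (fun u : SqSum ι => u n) hu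
  · exact congrFun h ⟨m, hm⟩

/-- `H₀` of a pair of extension operators is the space of functions on the complement of the
ranges. -/
noncomputable def H₀PushEquiv (hS : (Set.range f ∪ Set.range g)ᶜ.Finite) :
    H₀ (push f hf) (push g hg) ≃ₗ[ℂ] ((Set.range f ∪ Set.range g)ᶜ : Set ι) → ℂ :=
  Submodule.quotEquivOfEq _ (LinearMap.ker (restr (Set.range f ∪ Set.range g)ᶜ)) (by
    ext u
    rw [d₁, range_coprod]
    constructor
    · intro hu
      obtain ⟨v, hv, w, hw, rfl⟩ := Submodule.mem_sup.1 hu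
      ext ⟨m, hm⟩
      rw [mem_range_push] at hv hw
      have hm' := not_or.1 hm
      have h1 := hv m hm'.1
      have h2 := hw m hm'.2
      change v m + w m = 0
      rw [h1, h2, add_zero]
    · intro hu
      -- Split `u` into its part on the range of `f` and the rest, which is supported in the range
      -- of `g`.
      rw [← add_sub_cancel (push f hf (pull f hf u)) u]
      refine Submodule.add_mem_sup ⟨_, rfl⟩ (mem_range_push.2 fun m hm => ?_)
      change u m - push f hf (pull f hf u) m = 0
      by_cases hmf : m ∈ Set.range f
      · obtain ⟨n, rfl⟩ := hmf
        simp
      · rw [push_apply_of_notMem _ hmf, sub_zero]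
        exact congrFun hu ⟨m, not_or.2 ⟨hmf, hm⟩⟩) ≪≫ₗ
    quotKerEquivOfSurjective _ fun v => (exists_extension hS v).imp fun _ h => h.1

/-- `H₂` of a pair of composition operators is the space of functions on the complement of the
ranges. -/
noncomputable def H₂PullEquiv (hS : (Set.range f ∪ Set.range g)ᶜ.Finite) :
    H₂ (pull f hf) (pull g hg) ≃ₗ[ℂ] ((Set.range f ∪ Set.range g)ᶜ : Set ι) → ℂ :=
  LinearEquiv.ofBijective ((restr (Set.range f ∪ Set.range g)ᶜ).domRestrict _) <| by
    constructor
    · rw [injective_iff_map_eq_zero]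
      rintro ⟨u, hu⟩ h
      obtain ⟨h2, h1⟩ := Prod.mk.inj hu
      have h2 : pull g hg u = 0 := neg_eq_zero.1 h2
      have h1 : pull f hf u = 0 := h1
      refine Subtype.ext (lp.ext (funext fun m => ?_))
      by_cases hm : m ∈ Set.range f ∪ Set.range g
      · rcases hm with ⟨n, rfl⟩ | ⟨n, rfl⟩
        · exact congrArg (fun u : SqSum ι => u n) h1
        · exact congrArg (fun u : SqSum ι => u n) h2
      · exact congrFun h ⟨m, hm⟩
    · intro v
      obtain ⟨u, hu, h0⟩ := exists_extension hS v
      refine ⟨⟨u, Prod.ext (neg_eq_zero.2 ?_) ?_⟩, hu⟩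
      · ext n
        exact h0 _ fun h => h (Or.inr ⟨n, rfl⟩)
      · ext n
        exact h0 _ fun h => h (Or.inl ⟨n, rfl⟩)

theorem dimH_push_zero (hS : (Set.range f ∪ Set.range g)ᶜ.Finite) :
    dimH (push f hf) (push g hg) 0 = (Set.range f ∪ Set.range g)ᶜ.ncard := by
  have := hS.fintype
  rw [← Nat.card_coe_set_eq, Nat.card_eq_fintype_card, ← Module.finrank_fintype_fun_eq_card ℂ]
  exact (H₀PushEquiv hS).finrank_eq

theorem dimH_pull_two (hS : (Set.range f ∪ Set.range g)ᶜ.Finite) :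
    dimH (pull f hf) (pull g hg) 2 = (Set.range f ∪ Set.range g)ᶜ.ncard := by
  have := hS.fintype
  rw [← Nat.card_coe_set_eq, Nat.card_eq_fintype_card, ← Module.finrank_fintype_fun_eq_card ℂ]
  exact (H₂PullEquiv hS).finrank_eq

end SquareSummable

/-! ### Criteria for Fredholmness and vanishing homology -/

section Fredholm

variable {H : Type u} [NormedAddCommGroup H] [InnerProductSpace ℂ H] {T₁ T₂ : H →L[ℂ] H}

theorem isFredholm_of_finite_left (hT : Commute T₁ T₂)
    (hk : FiniteDimensional ℂ (LinearMap.ker (T₁ : H →ₗ[ℂ] H)))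
    (hc : FiniteDimensional ℂ (H ⧸ range (T₁ : H →ₗ[ℂ] H))) : IsFredholm T₁ T₂ :=
  (isFredholm_iff hT).2 ⟨.of_finiteDimensional _, .of_finiteDimensional _⟩

theorem subsingleton_H₂_of_injective (h : Function.Injective T₁) : Subsingleton (H₂ T₁ T₂) :=
  ⟨fun x y => Subtype.ext (h ((Prod.mk.inj x.2).2.trans (Prod.mk.inj y.2).2.symm))⟩

theorem dimH_two_of_injective (h : Function.Injective T₁) : dimH T₁ T₂ 2 = 0 :=
  have := subsingleton_H₂_of_injective (T₂ := T₂) h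
  finrank_zero_of_subsingleton

theorem subsingleton_H₀_of_surjective (h : Function.Surjective T₂) : Subsingleton (H₀ T₁ T₂) := by
  rw [Submodule.Quotient.subsingleton_iff, range_eq_top]
  exact fun x => (h x).imp' (fun y => (0, y)) fun y hy => by simp [d₁_apply, hy]

theorem dimH_zero_of_surjective (h : Function.Surjective T₂) : dimH T₁ T₂ 0 = 0 :=
  have := subsingleton_H₀_of_surjective (T₁ := T₁) h
  finrank_zero_of_subsingleton

theorem injective_pow (h : Function.Injective T₁) (k : ℕ) : Function.Injective (T₁ ^ k) := by
  rw [FunLike.coe_pow_eq_iterate]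
  exact h.iterate k

theorem surjective_pow (h : Function.Surjective T₁) (k : ℕ) : Function.Surjective (T₁ ^ k) := by
  rw [FunLike.coe_pow_eq_iterate]
  exact h.iterate k

/-- The index formula for powers, solved for the middle Hilbert function. -/
theorem hilbertFn_one_eq (hT : Commute T₁ T₂) (hF : IsFredholm T₁ T₂) (k : ℕ) :
    (hilbertFn T₁ T₂ 1 k : ℤ) =
      hilbertFn T₁ T₂ 2 k + hilbertFn T₁ T₂ 0 k - index T₁ T₂ * (k : ℤ) ^ 2 := by
  have h1 := index_pow_pow hT hF k k
  have h2 : index (T₁ ^ k) (T₂ ^ k) =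
    (hilbertFn T₁ T₂ 2 k : ℤ) - hilbertFn T₁ T₂ 1 k + hilbertFn T₁ T₂ 0 k := rfl
  linarith [h1, h2]

end Fredholm

theorem hasMultiplicity_of_eq_mul_sq {H : Type u} [NormedAddCommGroup H] [InnerProductSpace ℂ H]
    {T₁ T₂ : H →L[ℂ] H} {i : Fin 3} {n : ℕ} (h : ∀ k, hilbertFn T₁ T₂ i k = n * k ^ 2) :
    HasMultiplicity T₁ T₂ i n := by
  refine tendsto_const_nhds.congr' ?_
  filter_upwards [eventually_gt_atTop 0] with k hk
  have : (k : ℝ) ≠ 0 := by exact_mod_cast hk.ne'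
  rw [h]
  push_cast
  field_simp

end KoszulPair

namespace KoszulPair

open Module LinearMap

/-! ### Hilbert functions that are not eventually polynomial -/

section Parity

/-- An injective map commuting with `n ↦ n + 2` whose square is `n ↦ n + 4`, but which is not a
translation. -/
def skewShift (n : ℕ) : ℕ := if Even n then n + 1 else n + 3

/-- Translation by two. -/
def shiftTwo (n : ℕ) : ℕ := n + 2

theorem skewShift_injective : skewShift.Injective := fun m n h => by
  simp only [skewShift, Nat.even_iff] at h
  split_ifs at h <;> omega

theorem shiftTwo_injective : shiftTwo.Injective := add_left_injective 2

theorem skewShift_commute : Function.Commute skewShift shiftTwo := fun n => by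
  simp only [skewShift, shiftTwo, Nat.even_iff]
  split_ifs <;> omega

theorem shiftTwo_iterate (k n : ℕ) : shiftTwo^[k] n = n + 2 * k := by
  induction k with
  | zero => rfl
  | succ k ih => rw [Function.iterate_succ_apply', ih, shiftTwo]; ring

/-- Each step flips parity, so the increments `1` and `3` alternate and two steps add `4`. -/
theorem skewShift_iterate_even (m n : ℕ) : skewShift^[2 * m] n = n + 4 * m := by
  induction m with
  | zero => rfl
  | succ m ih =>
    rw [Nat.mul_succ, add_comm, Function.iterate_add_apply, ih]
    simp only [Function.iterate_succ_apply, Function.iterate_zero, _root_.id, skewShift, Nat.even_iff]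
    split_ifs <;> omega

theorem skewShift_iterate_odd (m n : ℕ) : skewShift^[2 * m + 1] n = skewShift n + 4 * m := by
  rw [Function.iterate_succ_apply, skewShift_iterate_even]

theorem compl_ranges_even (m : ℕ) :
    (Set.range skewShift^[2 * m] ∪ Set.range shiftTwo^[2 * m])ᶜ = Set.Iio (4 * m) := by
  ext x
  simp only [Set.mem_compl_iff, Set.mem_union, Set.mem_range, skewShift_iterate_even,
    shiftTwo_iterate, Set.mem_Iio]
  constructor
  · intro h
    by_contra hx
    exact h (Or.inl ⟨x - 4 * m, by omega⟩)
  · rintro h (⟨n, hn⟩ | ⟨n, hn⟩) <;> omega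

theorem compl_ranges_odd (m : ℕ) :
    (Set.range skewShift^[2 * m + 1] ∪ Set.range shiftTwo^[2 * m + 1])ᶜ =
      Set.Iio (4 * m + 1) := by
  ext x
  simp only [Set.mem_compl_iff, Set.mem_union, Set.mem_range, skewShift_iterate_odd,
    shiftTwo_iterate, Set.mem_Iio]
  constructor
  · intro h
    by_contra hx
    -- The translation reaches everything from `4 * m + 2` on; the one further point `4 * m + 1` is
    -- the image of `0` under the skew map.
    rcases Nat.lt_or_ge x (4 * m + 2) with hx' | hx'
    · exact h (Or.inl ⟨0, by simp [skewShift]; omega⟩)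
    · exact h (Or.inr ⟨x - (4 * m + 2), by omega⟩)
  · rintro h (⟨n, hn⟩ | ⟨n, hn⟩)
    · simp only [skewShift] at hn
      split_ifs at hn <;> omega
    · omega

theorem finite_compl_ranges (k : ℕ) :
    (Set.range skewShift^[k] ∪ Set.range shiftTwo^[k])ᶜ.Finite := by
  obtain ⟨m, rfl | rfl⟩ := k.even_or_odd'
  · rw [compl_ranges_even]; exact Set.finite_Iio _
  · rw [compl_ranges_odd]; exact Set.finite_Iio _

theorem finite_compl_range_skewShift : (Set.range skewShift)ᶜ.Finite := by
  refine (Set.finite_Iio 4).subset fun x hx => ?_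
  by_contra h
  refine hx ⟨skewShift (x - 4), ?_⟩
  have := skewShift_iterate_even 1 (x - 4)
  simp only [Set.mem_Iio] at h
  exact this.trans (by omega)

/-- Here `u k` is `2 * k` for even `k` and `2 * k - 1` for odd `k`; a polynomial right on the even
numbers is wrong on the odd ones. The term in `c` absorbs the index contribution to the middle
Hilbert function. -/
theorem not_polynomial_of_parity {u : ℕ → ℝ} (c : ℝ) (heven : ∀ m : ℕ, u (2 * m) = 4 * m)
    (hodd : ∀ m : ℕ, u (2 * m + 1) = 4 * m + 1) (p : Polynomial ℝ) :
    ¬ ∀ᶠ k : ℕ in atTop, u k - c * (k : ℝ) ^ 2 = p.eval (k : ℝ) := by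
  intro h
  obtain ⟨N, hN⟩ := eventually_atTop.1 h
  have hp : p + Polynomial.C c * Polynomial.X ^ 2 = Polynomial.C 2 * Polynomial.X := by
    refine Polynomial.eq_of_infinite_eval_eq _ _
      (Set.infinite_of_injective_forall_mem (f := fun m : ℕ => ((2 * (N + m) : ℕ) : ℝ))
        (fun a b hab => ?_) fun m => ?_)
    · have : 2 * (N + a) = 2 * (N + b) := Nat.cast_injective (R := ℝ) hab
      omega
    · have := hN (2 * (N + m)) (by omega)
      rw [heven] at this
      simp only [Set.mem_ofPred_eq, Polynomial.eval_add, Polynomial.eval_mul, Polynomial.eval_C,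
        Polynomial.eval_pow, Polynomial.eval_X, ← this]
      push_cast
      ring
  have h1 := hN (2 * N + 1) (by omega)
  have h2 := congrArg (Polynomial.eval ((2 * N + 1 : ℕ) : ℝ)) hp
  simp only [Polynomial.eval_add, Polynomial.eval_mul, Polynomial.eval_C,
    Polynomial.eval_pow, Polynomial.eval_X, ← h1, hodd] at h2
  push_cast at h2
  linarith

/-- The isometry on `ℓ²(ℕ)` induced by `skewShift`. -/
noncomputable def skewPush : SqSum ℕ →L[ℂ] SqSum ℕ := push skewShift skewShift_injective

/-- The isometry on `ℓ²(ℕ)` induced by `shiftTwo`. -/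
noncomputable def shiftPush : SqSum ℕ →L[ℂ] SqSum ℕ := push shiftTwo shiftTwo_injective

theorem commute_skewPush : Commute skewPush shiftPush := commute_push skewShift_commute

theorem isFredholm_skewPush : IsFredholm skewPush shiftPush := by
  refine isFredholm_of_finite_left commute_skewPush ?_
    (finiteDimensional_coker_push finite_compl_range_skewShift)
  have hker : LinearMap.ker (skewPush : SqSum ℕ →ₗ[ℂ] SqSum ℕ) = ⊥ :=
    ker_eq_bot.2 (push_injective (hf := skewShift_injective))
  rw [hker]
  infer_instance

theorem ncard_compl_ranges_even (m : ℕ) :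
    (Set.range skewShift^[2 * m] ∪ Set.range shiftTwo^[2 * m])ᶜ.ncard = 4 * m := by
  rw [compl_ranges_even, ← Finset.coe_Iio, Set.ncard_coe_finset, Nat.card_Iio]

theorem ncard_compl_ranges_odd (m : ℕ) :
    (Set.range skewShift^[2 * m + 1] ∪ Set.range shiftTwo^[2 * m + 1])ᶜ.ncard = 4 * m + 1 := by
  rw [compl_ranges_odd, ← Finset.coe_Iio, Set.ncard_coe_finset, Nat.card_Iio]

theorem hilbertFn_skewPush_zero (k : ℕ) : hilbertFn skewPush shiftPush 0 k =
    (Set.range skewShift^[k] ∪ Set.range shiftTwo^[k])ᶜ.ncard := by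
  rw [hilbertFn, skewPush, shiftPush, push_pow, push_pow, dimH_push_zero (finite_compl_ranges k)]

theorem hilbertFn_skewPull_two (k : ℕ) :
    hilbertFn (pull skewShift skewShift_injective) (pull shiftTwo shiftTwo_injective) 2 k =
      (Set.range skewShift^[k] ∪ Set.range shiftTwo^[k])ᶜ.ncard := by
  rw [hilbertFn, pull_pow, pull_pow, dimH_pull_two (finite_compl_ranges k)]

theorem exists_not_eventuallyPolynomial (i : Fin 3) :
    ∃ T₁ T₂ : SqSum ℕ →L[ℂ] SqSum ℕ, Commute T₁ T₂ ∧ IsFredholm T₁ T₂ ∧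
      ¬ EventuallyPolynomial (hilbertFn T₁ T₂ i) := by
  fin_cases i
  · refine ⟨_, _, commute_skewPush, isFredholm_skewPush, ?_⟩
    rintro ⟨p, hp⟩
    refine not_polynomial_of_parity (u := fun k => hilbertFn skewPush shiftPush 0 k) 0
      (fun m => ?_) (fun m => ?_) p (by simpa using hp)
    · rw [hilbertFn_skewPush_zero, ncard_compl_ranges_even]; push_cast; rfl
    · rw [hilbertFn_skewPush_zero, ncard_compl_ranges_odd]; push_cast; rfl
  · refine ⟨_, _, commute_skewPush, isFredholm_skewPush, ?_⟩
    rintro ⟨p, hp⟩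
    refine not_polynomial_of_parity (u := fun k => hilbertFn skewPush shiftPush 0 k)
      (index skewPush shiftPush) (fun m => ?_) (fun m => ?_) p ?_
    · rw [hilbertFn_skewPush_zero, ncard_compl_ranges_even]; push_cast; rfl
    · rw [hilbertFn_skewPush_zero, ncard_compl_ranges_odd]; push_cast; rfl
    · filter_upwards [hp] with k hk
      rw [← hk]
      have h := hilbertFn_one_eq commute_skewPush isFredholm_skewPush k
      have h2 : hilbertFn skewPush shiftPush 2 k = 0 :=
        dimH_two_of_injective (injective_pow push_injective k)
      rw [h2, Nat.cast_zero, zero_add] at h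
      exact_mod_cast h.symm
  · refine ⟨pull skewShift skewShift_injective, pull shiftTwo shiftTwo_injective,
      commute_pull skewShift_commute, isFredholm_of_finite_left (commute_pull skewShift_commute)
        (finiteDimensional_ker_pull finite_compl_range_skewShift) ?_, ?_⟩
    · rw [range_eq_top.2 pull_surjective]
      infer_instance
    rintro ⟨p, hp⟩
    refine not_polynomial_of_parity (u := fun k => hilbertFn (pull skewShift skewShift_injective)
      (pull shiftTwo shiftTwo_injective) 2 k) 0 (fun m => ?_) (fun m => ?_) p (by simpa using hp)
    · rw [hilbertFn_skewPull_two, ncard_compl_ranges_even]; push_cast; rfl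
    · rw [hilbertFn_skewPull_two, ncard_compl_ranges_odd]; push_cast; rfl

end Parity

/-! ### Fredholm pairs from injections with a reflecting condition -/

section Reflecting

variable {ι : Type} {f g : ι → ι} {hf : f.Injective} {hg : g.Injective}

/-- The two operators behave like a regular sequence. For a cycle `(u, v)`, evaluation at `g m` with
`m` outside the range of `f` gives `v m = 0`, so `v` lies in the range of `push f`; injectivity then
makes the cycle a boundary. -/
theorem isFredholm_push (h : Function.Commute f g)
    (hfg : ∀ m, g m ∈ Set.range f → m ∈ Set.range f)
    (hS : (Set.range f ∪ Set.range g)ᶜ.Finite) : IsFredholm (push f hf) (push g hg) := by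
  have := hS.to_subtype
  have := subsingleton_H₂_of_injective (T₂ := push g hg) (push_injective (hf := hf))
  refine ⟨(H₀PushEquiv hS).symm.finiteDimensional, ?_, inferInstance⟩
  have : Subsingleton (H₁ (push f hf) (push g hg)) := by
    rw [Submodule.Quotient.subsingleton_iff, eq_top_iff]
    rintro ⟨⟨u, v⟩, huv⟩ -
    have huv : push f hf u + push g hg v = 0 := huv
    have hv : push f hf (pull f hf v) = v := push_pull fun m hm => by
      have h1 : push f hf u (g m) + push g hg v (g m) = 0 :=
        congrArg (fun w : SqSum ι => w (g m)) huv
      rwa [push_apply, push_apply_of_notMem _ fun h => hm (hfg m h), zero_add] at h1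
    refine ⟨pull f hf v, Prod.ext ?_ hv⟩
    have h1 : push f hf (u + push g hg (pull f hf v)) = push f hf 0 := by
      rw [map_add, commute_apply (commute_push h), hv, map_zero, huv]
    exact neg_eq_of_add_eq_zero_left (push_injective h1)
  infer_instance

/-- The cokernel of `pull f` vanishes. On its kernel `pull g` is onto, since the reflecting
condition makes `push g` preserve that kernel. -/
theorem isFredholm_pull (h : Function.Commute f g)
    (hfg : ∀ m, g m ∈ Set.range f → m ∈ Set.range f)
    (hS : (Set.range f ∪ Set.range g)ᶜ.Finite) : IsFredholm (pull f hf) (pull g hg) := by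
  have := hS.to_subtype
  have hC : Subsingleton (SqSum ι ⧸ range (pull f hf : SqSum ι →ₗ[ℂ] SqSum ι)) := by
    rw [Submodule.Quotient.subsingleton_iff, range_eq_top]
    exact pull_surjective
  have hsurj : Function.Surjective (onKer (commute_pull (hf := hf) (hg := hg) h)) := by
    rintro ⟨v, hv⟩
    have hv : pull f hf v = 0 := hv
    refine ⟨⟨push g hg v, ?_⟩, Subtype.ext (pull_push (hf := hg) v)⟩
    ext n
    change push g hg v (f n) = 0
    by_cases hn : f n ∈ Set.range g
    · obtain ⟨m, hm⟩ := hn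
      obtain ⟨l, rfl⟩ := hfg m ⟨n, hm.symm⟩
      rw [← hm, push_apply]
      exact congrArg (fun w : SqSum ι => w l) hv
    · exact push_apply_of_notMem _ hn
  refine (isFredholm_iff (commute_pull h)).2 ⟨⟨?_, ?_⟩, .of_finiteDimensional _⟩
  · exact ((H₂PullEquiv hS).symm ≪≫ₗ H₂Equiv (commute_pull h)).finiteDimensional
  · rw [range_eq_top.2 hsurj]
    infer_instance

/-- Only the action of `pull g` on the cokernel of `push f` matters. It is onto, and its kernel
embeds into the functions on the points missed by both ranges; a vector equal to `1` there shows
that the kernel is nonzero. -/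
theorem isFredholm_push_pull (h : Function.Commute f g)
    (hfg : ∀ m, g m ∈ Set.range f → m ∈ Set.range f)
    (hS : (Set.range f ∪ Set.range g)ᶜ.Finite) (hne : (Set.range f ∪ Set.range g)ᶜ.Nonempty) :
    IsFredholm (push f hf) (pull g hg) ∧ 0 < dimH (push f hf) (pull g hg) 1 := by
  have := hS.to_subtype
  have hcomm : Commute (push f hf) (pull g hg) := commute_push_pull h hfg
  have hK : Subsingleton (LinearMap.ker (push f hf : SqSum ι →ₗ[ℂ] SqSum ι)) := by
    rw [ker_eq_bot.2 push_injective]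
    infer_instance
  have hsurj : Function.Surjective (onCoker hcomm) := by
    rintro ⟨v⟩
    exact ⟨Submodule.Quotient.mk (push g hg v), congrArg Submodule.Quotient.mk (pull_push (hf := hg) v)⟩
  let ρ : (SqSum ι ⧸ range (push f hf : SqSum ι →ₗ[ℂ] SqSum ι)) →ₗ[ℂ]
      ((Set.range f ∪ Set.range g)ᶜ : Set ι) → ℂ :=
    Submodule.liftQ _ (restr _) <| by
      rintro _ ⟨u, rfl⟩
      exact funext fun m => push_apply_of_notMem (hf := hf) u fun h => m.2 (Or.inl h)
  have hF : IsFredholm (push f hf) (pull g hg) := by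
    refine (isFredholm_iff hcomm).2 ⟨.of_finiteDimensional _, ⟨?_, ?_⟩⟩
    · refine .of_injective (ρ.domRestrict _) ?_
      rw [injective_iff_map_eq_zero]
      rintro ⟨⟨v⟩, hv⟩ h0
      have hv : pull g hg v ∈ range (push f hf : SqSum ι →ₗ[ℂ] SqSum ι) :=
        (Submodule.Quotient.mk_eq_zero _).1 hv
      rw [mem_range_push] at hv
      refine Subtype.ext ((Submodule.Quotient.mk_eq_zero _).2 (mem_range_push.2 fun m hm => ?_))
      by_cases hmg : m ∈ Set.range g
      · obtain ⟨n, rfl⟩ := hmg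
        refine hv n ?_
        rintro ⟨l, rfl⟩
        exact hm ⟨g l, h l⟩
      · exact congrFun h0 ⟨m, not_or.2 ⟨hm, hmg⟩⟩
    · rw [range_eq_top.2 hsurj]
      infer_instance
  refine ⟨hF, ?_⟩
  have hfin := ((isFredholm_iff hcomm).1 hF).2.finite_ker
  rw [dimH_one hcomm hF]
  refine Nat.add_pos_right _ (Module.finrank_pos_iff.2 ?_)
  obtain ⟨m, hm⟩ := hne
  obtain ⟨u, hu, h0⟩ := exists_extension hS 1
  refine ⟨⟨Submodule.Quotient.mk u, ?_⟩, 0, fun heq => ?_⟩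
  · refine (Submodule.Quotient.mk_eq_zero _).2 ?_
    have : pull g hg u = 0 := by
      ext n
      exact h0 _ fun h => h (Or.inr ⟨n, rfl⟩)
    change pull g hg u ∈ _
    rw [this]
    exact zero_mem _
  · have hu0 := (Submodule.Quotient.mk_eq_zero _).1 (congrArg Subtype.val heq)
    have h1 := mem_range_push.1 hu0 m fun h => hm (Or.inl h)
    have h2 : u m = 1 := congrFun hu ⟨m, hm⟩
    exact one_ne_zero (h2.symm.trans h1)

end Reflecting

/-! ### Coordinate shifts on `ℓ²(ℕ × ℕ)` and positive multiplicities -/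

section Bidisc

/-- Translation of the first coordinate. -/
def shiftFst (p : ℕ × ℕ) : ℕ × ℕ := (p.1 + 1, p.2)

/-- Translation of the second coordinate. -/
def shiftSnd (p : ℕ × ℕ) : ℕ × ℕ := (p.1, p.2 + 1)

theorem shiftFst_injective : shiftFst.Injective := fun p q h => by
  simpa [shiftFst, Prod.ext_iff] using h

theorem shiftSnd_injective : shiftSnd.Injective := fun p q h => by
  simpa [shiftSnd, Prod.ext_iff] using h

theorem shiftFst_commute : Function.Commute shiftFst shiftSnd := fun _ => rfl

theorem mem_range_of_shiftSnd_mem (p : ℕ × ℕ) :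
    shiftSnd p ∈ Set.range shiftFst → p ∈ Set.range shiftFst := by
  rintro ⟨q, hq⟩
  exact ⟨(q.1, p.2), Prod.ext (congrArg Prod.fst hq :) rfl⟩

theorem shiftFst_iterate (k : ℕ) (p : ℕ × ℕ) : shiftFst^[k] p = (p.1 + k, p.2) := by
  induction k with
  | zero => rfl
  | succ k ih => rw [Function.iterate_succ_apply', ih]; rfl

theorem shiftSnd_iterate (k : ℕ) (p : ℕ × ℕ) : shiftSnd^[k] p = (p.1, p.2 + k) := by
  induction k with
  | zero => rfl
  | succ k ih => rw [Function.iterate_succ_apply', ih]; rfl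

theorem compl_ranges_bidisc (k : ℕ) : (Set.range shiftFst^[k] ∪ Set.range shiftSnd^[k])ᶜ =
    ((Finset.range k ×ˢ Finset.range k : Finset (ℕ × ℕ)) : Set (ℕ × ℕ)) := by
  ext ⟨a, b⟩
  simp only [Set.mem_compl_iff, Set.mem_union, Set.mem_range, shiftFst_iterate, shiftSnd_iterate,
    Finset.coe_product, Set.mem_prod, Finset.mem_coe, Finset.mem_range, Prod.mk.injEq]
  constructor
  · intro h
    by_contra hx
    rcases Nat.lt_or_ge a k with ha | ha
    · exact h (Or.inr ⟨(a, b - k), rfl, by simp only; omega⟩)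
    · exact h (Or.inl ⟨(a - k, b), by simp only; omega, rfl⟩)
  · rintro h (⟨p, hp⟩ | ⟨p, hp⟩) <;> omega

theorem finite_compl_ranges_bidisc (k : ℕ) :
    (Set.range shiftFst^[k] ∪ Set.range shiftSnd^[k])ᶜ.Finite := by
  rw [compl_ranges_bidisc]
  exact Finset.finite_toSet _

theorem ncard_compl_ranges_bidisc (k : ℕ) :
    (Set.range shiftFst^[k] ∪ Set.range shiftSnd^[k])ᶜ.ncard = k ^ 2 := by
  rw [compl_ranges_bidisc, Set.ncard_coe_finset, Finset.card_product, Finset.card_range, sq]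

theorem exists_pos_hasMultiplicity (i : Fin 3) :
    ∃ T₁ T₂ : SqSum (ℕ × ℕ) →L[ℂ] SqSum (ℕ × ℕ), Commute T₁ T₂ ∧ IsFredholm T₁ T₂ ∧
      ∃ e : ℤ, 0 < e ∧ HasMultiplicity T₁ T₂ i e := by
  have hS := finite_compl_ranges_bidisc 1
  fin_cases i
  · refine ⟨push shiftFst shiftFst_injective, push shiftSnd shiftSnd_injective,
      commute_push shiftFst_commute,
      isFredholm_push shiftFst_commute mem_range_of_shiftSnd_mem hS, _, Nat.cast_pos.2 one_pos,
      hasMultiplicity_of_eq_mul_sq fun k => ?_⟩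
    rw [one_mul]
    change dimH _ _ 0 = _
    rw [push_pow, push_pow, dimH_push_zero (finite_compl_ranges_bidisc k),
      ncard_compl_ranges_bidisc]
  · have hcomm : Commute (push shiftFst shiftFst_injective) (pull shiftSnd shiftSnd_injective) :=
      commute_push_pull shiftFst_commute mem_range_of_shiftSnd_mem
    obtain ⟨hF, hpos⟩ := isFredholm_push_pull (hf := shiftFst_injective) (hg := shiftSnd_injective)
      shiftFst_commute mem_range_of_shiftSnd_mem hS
      (Set.nonempty_of_ncard_ne_zero (by exact (ncard_compl_ranges_bidisc 1).trans_ne (by norm_num)))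
    refine ⟨_, _, hcomm, hF, _, Nat.cast_pos.2 hpos, hasMultiplicity_of_eq_mul_sq fun k => ?_⟩
    have h0 : ∀ j, hilbertFn (push shiftFst shiftFst_injective)
        (pull shiftSnd shiftSnd_injective) 0 j = 0 := fun j =>
      dimH_zero_of_surjective (surjective_pow pull_surjective j)
    have h2 : ∀ j, hilbertFn (push shiftFst shiftFst_injective)
        (pull shiftSnd shiftSnd_injective) 2 j = 0 := fun j =>
      dimH_two_of_injective (injective_pow push_injective j)
    -- With both outer homologies zero, the middle function is `-index * k ^ 2`; its value at `k =
    -- 1` identifies the coefficient.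
    have hk := hilbertFn_one_eq hcomm hF k
    have h1 := hilbertFn_one_eq hcomm hF 1
    rw [h0, h2] at hk h1
    have h1' : (dimH (push shiftFst shiftFst_injective) (pull shiftSnd shiftSnd_injective) 1 : ℤ) =
        hilbertFn (push shiftFst shiftFst_injective) (pull shiftSnd shiftSnd_injective) 1 1 := by
      rw [hilbertFn, pow_one, pow_one]
    zify
    refine hk.trans ?_
    rw [h1', h1]
    push_cast
    ring
  · refine ⟨pull shiftFst shiftFst_injective, pull shiftSnd shiftSnd_injective,
      commute_pull shiftFst_commute,
      isFredholm_pull shiftFst_commute mem_range_of_shiftSnd_mem hS, _, Nat.cast_pos.2 one_pos,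
      hasMultiplicity_of_eq_mul_sq fun k => ?_⟩
    rw [one_mul]
    change dimH _ _ 2 = _
    rw [pull_pow, pull_pow, dimH_pull_two (finite_compl_ranges_bidisc k),
      ncard_compl_ranges_bidisc]

end Bidisc

end KoszulPair
theorem theorem3 :
    -- limits, index formula and behaviour under powers, for every commuting Fredholm pair
    (∀ (H : Type u) [NormedAddCommGroup H] [InnerProductSpace ℂ H] [CompleteSpace H]
        (T₁ T₂ : H →L[ℂ] H), Commute T₁ T₂ → KoszulPair.IsFredholm T₁ T₂ →
      (∀ t s : ℕ, KoszulPair.IsFredholm (T₁ ^ t) (T₂ ^ s)) ∧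
      ∃ e : Fin 3 → ℤ,
        (∀ i : Fin 3, KoszulPair.HasMultiplicity T₁ T₂ i (e i)) ∧
        KoszulPair.index T₁ T₂ = e 2 - e 1 + e 0 ∧
        (∀ (t s : ℕ) (i : Fin 3),
          KoszulPair.HasMultiplicity (T₁ ^ t) (T₂ ^ s) i ((t : ℤ) * (s : ℤ) * e i))) ∧
    -- each Hilbert function may fail to be a polynomial for large arguments
    (∀ i : Fin 3, ∃ (H : Type) (_ : NormedAddCommGroup H) (_ : InnerProductSpace ℂ H)
        (_ : CompleteSpace H) (T₁ T₂ : H →L[ℂ] H), Commute T₁ T₂ ∧ KoszulPair.IsFredholm T₁ T₂ ∧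
      ¬ KoszulPair.EventuallyPolynomial (KoszulPair.hilbertFn T₁ T₂ i)) ∧
    -- each multiplicity can be strictly positive
    (∀ i : Fin 3, ∃ (H : Type) (_ : NormedAddCommGroup H) (_ : InnerProductSpace ℂ H)
        (_ : CompleteSpace H) (T₁ T₂ : H →L[ℂ] H), Commute T₁ T₂ ∧ KoszulPair.IsFredholm T₁ T₂ ∧
      ∃ e : ℤ, 0 < e ∧ KoszulPair.HasMultiplicity T₁ T₂ i e) := by
  refine ⟨fun H _ _ _ T₁ T₂ hT hF => ⟨hF.pow_pow hT, ?_⟩, fun i => ?_, fun i => ?_⟩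
  · obtain ⟨e, hidx, he⟩ := KoszulPair.exists_multiplicities hT hF
    exact ⟨e, fun i => by simpa using he 1 1 i, hidx, he⟩
  · exact ⟨_, _, _, inferInstance, KoszulPair.exists_not_eventuallyPolynomial i⟩
  · exact ⟨_, _, _, inferInstance, KoszulPair.exists_pos_hasMultiplicity i⟩
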